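/- **Setting.** Let $P\subset\mathbb R^n$ be a full-dimensional polytope, partitioned into full-dimensional polytopes $q_1,\dots,q_p$ with pairwise disjoint interiors and $P=\bigcup_j q_j$. Agents $i=1,\dots,M$ ($M\ge 1$) obey $\dot{\mathbf x}_i=\mathbf A_i\mathbf x_i+\mathbf B_i\mathbf u_i+\mathbf b_i$ with $\mathbf u_i\in U_i\subset\mathbb R^m$, $U_i$ a convex polytope. Agent $i$ has a transition system on the regions $\{q_1,\dots,q_p\}$ with initial states, transitions, positive weights, labels $L_i$, intruder outputs $H_i$ and secret states $Q_S^i$; $\mathcal T_g$ is the synchronous product, with added weights, and $L_g$, $H_g$ are the tuples of labels and outputs. An infinite path $\tau$ of $\mathcal T_g$ is *Type-A secure* if there is a path $\tau'$ of $\mathcal T_g$ with $H_g(\tau)=H_g(\tau')$ such that, for all $i,j$, $\tau_i(j)\in Q_S^i$ implies $\tau'_i(j)\notin Q_S^i$; it is *Type-B secure* if, for all $i,j$, $\tau_i(j)\in Q_S^i$ implies $H_k(\tau_k(j))=H_i(\tau_i(j))$ for some $k\ne i$. **Secure abstraction $\mathcal W$.** For Type-B, restrict $\mathcal T_g$ to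 the states $q$ in which every agent $i$ with $q^i\in Q_S^i$ has the same output as some other agent. For Type-A, take the pairs (real state, copy state) of states of $\mathcal T_g$ with equal outputs in which no agent is secret in both, both components moving along $\mathcal T_g$; weights and labels are those of the real state. For Type-A/B, apply the Type-A construction to the Type-B system. **Transition check.** Fix $\gamma,\varepsilon>0$. Keep only transitions $(q,q')$ of $\mathcal W$ for which the trajectory optimization returns a segment: times $0<t_c<t_f$ and, for each real and copy agent, a continuous trajectory on $[0,t_f]$ and inputs in $U_i$, locally Lipschitz on $[0,t_c)$ and on $[t_c,t_f)$, that satisfy the dynamics and lead from the centroid of the agent's region in $q$ to the centroid of its region in $q'$. If these two regions differ, the agent is in their intersection at $t_c$. On $[0,t_c)$ every facet $h_j=\mathbf p_j^\top\mathbf x+g_j=0$ of the first region is guarded either by the barrier inequality $\mathbf p_j^\top\dot{\mathbf x}_i\ge-\gamma(h_j(\mathbf x_i)-\varepsilon)$ or directly by $h_j(\mathbf x_i)>0$ on $(0,t_c)$; likewise for the second region on $[t_c,t_f)$, respectively $(t_c,t_f)$. **Algorithm.** Let $\phi$ be an LTL formula over the propositions of all agents and $\mathcal B_\phi=(S,S_0,F,\delta)$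 a nondeterministic Büchi automaton that accepts exactly the traces satisfying $\phi$. The product automaton has the pairs (state of $\mathcal W$, state of $\mathcal B_\phi$) as states, initial and accepting when both components are initial, respectively when the second component is accepting, and a transition from $(q,s)$ to $(q',s')$ if $(q,q')$ is a retained transition and $s'\in\delta(s,L(q))$. For each accepting state the algorithm computes a shortest prefix from an initial state to it and a shortest cycle (with at least one transition) through it. With $\beta\in[0,1]$, it keeps a pair of least cost $\beta J_{\rm prefix}+(1-\beta)J_{\rm suffix}$, forms the prefix–suffix path $\sigma^\star$, and concatenates the segments of its transitions into $\mathbf x^\star(t)$, $\mathbf u^\star(t)$, $t\ge 0$. Let $\tau^\star$ be the sequence of real global states of $\sigma^\star$. **Theorem.** The algorithm returns a plan if and only if the product automaton has an infinite accepting path. Every plan that it returns has the following properties, whichever constraints (Type-A, Type-B or both) are imposed. (iii) $\mathbf x^\star$ is dynamically feasible: for every real and copy agent it is continuous on $[0,\infty)$, stays in $P$, satisfies the agent's dynamics with inputs $\mathbf u^\star(t)\in U_i$ that are piecewise locally Lipschitz, and is at the centroids of the regions of $\sigma^\star(k)$ when the $k$-th segment starts. (i), (ii) Between consecutive crossing instants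 (with $0$ as the first step instant) the real and the copy trajectories are in the regions prescribed by $\sigma^\star$, where an agent crossing a facet counts as being in the region it enters. The path $\tau^\star$ is a path of $\mathcal T_g$, its trace satisfies $\phi$, and it has the security properties imposed. Moreover, if a step of $\tau^\star$ that moves no agent occurs only when no agent ever moves again, then the real trajectory $\mathbf x^\star$ induces a unique global path, namely the sequence of global states at the successive switching times of all agents (the last state being repeated if switching stops). The trace of this induced path satisfies $\phi$, and the path has the security properties imposed. -/

import Mathlib

open Set Filter Topology MeasureTheory

namespace SecurePlanning

/-! ### Polytopes, partitioned workspace, affine dynamics -/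

abbrev Vec (n : ℕ) := EuclideanSpace ℝ (Fin n)

/-- A full-dimensional polytope, given by finitely many closed half-spaces
`0 ≤ ⟪normal j, x⟫ + offset j`. -/
structure Polytope (n : ℕ) where
  d : ℕ
  normal : Fin d → Vec n
  offset : Fin d → ℝ
  normal_ne_zero : ∀ j, normal j ≠ 0
  bounded : Bornology.IsBounded {x : Vec n | ∀ j, 0 ≤ inner ℝ (normal j) x + offset j}
  full_dim : (interior {x : Vec n | ∀ j, 0 ≤ inner ℝ (normal j) x + offset j}).Nonempty

namespace Polytope
variable {n : ℕ}

/-- The affine function whose zero set carries the `j`-th facet. -/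
noncomputable def h (C : Polytope n) (j : Fin C.d) (x : Vec n) : ℝ := inner ℝ (C.normal j) x + C.offset j

def carrier (C : Polytope n) : Set (Vec n) := {x | ∀ j, 0 ≤ C.h j x}

/-- The centroid (barycentre with respect to Lebesgue measure). -/
noncomputable def centroid (C : Polytope n) : Vec n := ⨍ x in C.carrier, x ∂volume

end Polytope

/-- Affine dynamics `ẋ = A x + B u + b` with inputs in a convex polytope `U`. -/
structure Dynamics (n m : ℕ) where
  A : Matrix (Fin n) (Fin n) ℝ
  B : Matrix (Fin n) (Fin m) ℝ
  b : Vec n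
  U : Set (Vec m)
  U_polytope : ∃ V : Finset (Vec m), U = convexHull ℝ (V : Set (Vec m))

def Dynamics.velocity {n m : ℕ} (D : Dynamics n m) (x : Vec n) (u : Vec m) : Vec n :=
  WithLp.toLp 2 (D.A.mulVec x.ofLp + D.B.mulVec u.ofLp + D.b.ofLp)

/-- On the time set `I`, the input `u` is locally Lipschitz and admissible, and `x` solves the
dynamics under it. -/
def Dynamics.SolvesOn {n m : ℕ} (D : Dynamics n m) (x : ℝ → Vec n) (u : ℝ → Vec m)
    (I : Set ℝ) : Prop :=
  LocallyLipschitzOn I u ∧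
    ∀ t ∈ I, u t ∈ D.U ∧ HasDerivWithinAt x (D.velocity (x t) (u t)) I t

/-- `M` agents with affine dynamics in a polytopic workspace `P` that is partitioned into `p`
polytopes which do not overlap (adjacent ones share boundary points only). -/
structure System (M n m p : ℕ) where
  P : Polytope n
  cell : Fin p → Polytope n
  cover : P.carrier = ⋃ j, (cell j).carrier
  non_overlapping : Pairwise fun j k =>
    Disjoint (interior (cell j).carrier) (interior (cell k).carrier)
  dyn : Fin M → Dynamics n m

/-! ### Weighted transition systems -/

/-- The weighted transition system of one agent over the regions `Fin p`, with labels, outputs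
observed by the intruder, and secret regions. -/
structure AgentWTS (p : ℕ) (AP Y : Type*) where
  init : Set (Fin p)
  trans : Fin p → Fin p → Prop
  w : Fin p → Fin p → ℝ
  w_pos : ∀ q q', 0 < w q q'
  L : Fin p → Set AP
  H : Fin p → Y
  secret : Set (Fin p)

/-- A weighted, labelled transition system with states in `X`. -/
structure TS (X AP : Type*) where
  states : Set X
  init : Set X
  trans : X → X → Prop
  w : X → X → ℝ
  L : X → Set AP

namespace TS
variable {X AP : Type*}

/-- Infinite paths (time starts at `0`). -/
def IsPath (W : TS X AP) (τ : ℕ → X) : Prop :=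
  τ 0 ∈ W.init ∧ ∀ k, W.trans (τ k) (τ (k + 1))

/-- Keep only the states in `K`. -/
def restrict (W : TS X AP) (K : Set X) : TS X AP where
  states := W.states ∩ K
  init := W.init ∩ K
  trans q q' := q ∈ K ∧ q' ∈ K ∧ W.trans q q'
  w := W.w
  L := W.L

/-- Keep only the transitions that pass a test. -/
def prune (W : TS X AP) (keep : X → X → Prop) : TS X AP :=
  { W with trans := fun q q' => W.trans q q' ∧ keep q q' }

/-- Pairs (real state, copy state) that have the same output. -/
def twin {Z : Type*} (W : TS X AP) (H : X → Z) : TS (X × X) AP where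
  states := {q | q.1 ∈ W.states ∧ q.2 ∈ W.states ∧ H q.1 = H q.2}
  init := {q | q.1 ∈ W.init ∧ q.2 ∈ W.init ∧ H q.1 = H q.2}
  trans q q' := W.trans q.1 q'.1 ∧ W.trans q.2 q'.2 ∧ H q.1 = H q.2 ∧ H q'.1 = H q'.2
  w q q' := W.w q.1 q'.1
  L q := W.L q.1

end TS

section Security
variable {M p : ℕ} {AP : Fin M → Type*} {Y : Type*}

/-- Global states: one region for each agent. -/
abbrev Global (M p : ℕ) := Fin M → Fin p

/-- The synchronous product of the agents' systems. A tuple of label sets, one for each agent, is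
encoded as one set of propositions tagged by the agent. -/
def gWTS (T : (i : Fin M) → AgentWTS p (AP i) Y) : TS (Global M p) (Σ i, AP i) where
  states := univ
  init := {q | ∀ i, q i ∈ (T i).init}
  trans q q' := ∀ i, (T i).trans (q i) (q' i)
  w q q' := ∑ i, (T i).w (q i) (q' i)
  L q := {a | a.2 ∈ (T a.1).L (q a.1)}

/-- The global output. -/
def output (T : (i : Fin M) → AgentWTS p (AP i) Y) (q : Global M p) : Fin M → Y :=
  fun i => (T i).H (q i)

/-- Type-A security of a global path. -/
def TypeASecure (T : (i : Fin M) → AgentWTS p (AP i) Y) (τ : ℕ → Global M p) : Prop :=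
  ∃ τ' : ℕ → Global M p, (gWTS T).IsPath τ' ∧ (∀ k, output T (τ k) = output T (τ' k)) ∧
    ∀ i k, τ k i ∈ (T i).secret → τ' k i ∉ (T i).secret

/-- Type-B security of a global path. -/
def TypeBSecure (T : (i : Fin M) → AgentWTS p (AP i) Y) (τ : ℕ → Global M p) : Prop :=
  ∀ i k, τ k i ∈ (T i).secret → ∃ l, l ≠ i ∧ (T l).H (τ k l) = (T i).H (τ k i)

/-- The Type-B global system. -/
def typeBWTS (T : (i : Fin M) → AgentWTS p (AP i) Y) : TS (Global M p) (Σ i, AP i) :=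
  (gWTS T).restrict
    {q | ∀ i, q i ∈ (T i).secret → ∃ k, k ≠ i ∧ (T i).H (q i) = (T k).H (q k)}

/-- The secure twin system over a system `G` of global states: no agent is in a secret region
both in the real and in the copy state. -/
def secureTwin (T : (i : Fin M) → AgentWTS p (AP i) Y) (G : TS (Global M p) (Σ i, AP i)) :
    TS (Global M p × Global M p) (Σ i, AP i) :=
  (G.twin (output T)).restrict {q | ¬ ∃ i, q.1 i ∈ (T i).secret ∧ q.2 i ∈ (T i).secret}

/-- Which of the security constraints are imposed. -/
inductive Security
  | typeA
  | typeB
  | typeAB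

def Security.imposesA : Security → Prop
  | .typeA => True
  | .typeB => False
  | .typeAB => True

def Security.imposesB : Security → Prop
  | .typeA => False
  | .typeB => True
  | .typeAB => True

/-- A transition system whose states consist of one global state for each element of `κ`
(the real one and possibly a copy). -/
structure Abstraction (M p : ℕ) (AP : Type*) where
  X : Type
  κ : Type
  real : κ
  part : X → κ → Global M p
  ts : TS X AP

/-- The secure abstraction for each kind of security; in twin states, `true` is the real part and
`false` the copy. -/
def secureAbstraction (T : (i : Fin M) → AgentWTS p (AP i) Y) :
    Security → Abstraction M p (Σ i, AP i)
  | .typeA =>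
    { X := Global M p × Global M p, κ := Bool, real := true
      part := fun q c => if c then q.1 else q.2
      ts := secureTwin T (gWTS T) }
  | .typeB =>
    { X := Global M p, κ := Unit, real := ()
      part := fun q _ => q
      ts := typeBWTS T }
  | .typeAB =>
    { X := Global M p × Global M p, κ := Bool, real := true
      part := fun q c => if c then q.1 else q.2
      ts := secureTwin T (typeBWTS T) }

end Security

/-! ### Linear temporal logic, Büchi automata, product automaton -/

inductive LTL (AP : Type*)
  | atom (a : AP)
  | neg (φ : LTL AP)
  | conj (φ ψ : LTL AP)
  | next (φ : LTL AP)
  | untl (φ ψ : LTL AP)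

/-- Satisfaction of a formula by an infinite trace. -/
def LTL.Sat {AP : Type*} : LTL AP → (ℕ → Set AP) → Prop
  | .atom a, r => a ∈ r 0
  | .neg φ, r => ¬ φ.Sat r
  | .conj φ ψ, r => φ.Sat r ∧ ψ.Sat r
  | .next φ, r => φ.Sat fun j => r (j + 1)
  | .untl φ ψ, r => ∃ k, ψ.Sat (fun j => r (j + k)) ∧ ∀ l < k, φ.Sat fun j => r (j + l)

/-- Nondeterministic Büchi automata over the alphabet `A`. -/
structure NBA (A : Type*) where
  S : Type
  finite : Finite S
  init : Set S
  acc : Set S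
  δ : S → A → Set S

def NBA.Accepts {A : Type*} (B : NBA A) (r : ℕ → A) : Prop :=
  ∃ s : ℕ → B.S, s 0 ∈ B.init ∧ (∀ k, s (k + 1) ∈ B.δ (s k) (r k)) ∧
    ∃ᶠ k in atTop, s k ∈ B.acc

/-- A weighted Büchi automaton without input letters. -/
structure PBA (Z : Type*) where
  init : Set Z
  acc : Set Z
  δ : Z → Z → Prop
  w : Z → Z → ℝ

/-- The product of a transition system and an automaton; the automaton reads the label of the
state that is left, so that the label of the initial state is read first. -/
def product {X AP : Type*} (W : TS X AP) (B : NBA (Set AP)) : PBA (X × B.S) where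
  init := {z | z.1 ∈ W.init ∧ z.2 ∈ B.init}
  acc := {z | z.1 ∈ W.states ∧ z.2 ∈ B.acc}
  δ z z' := W.trans z.1 z'.1 ∧ z'.2 ∈ B.δ z.2 (W.L z.1)
  w z z' := W.w z.1 z'.1

namespace PBA
variable {Z : Type*}

/-- Infinite accepting paths. -/
def IsAccepting (Q : PBA Z) (ρ : ℕ → Z) : Prop :=
  ρ 0 ∈ Q.init ∧ (∀ k, Q.δ (ρ k) (ρ (k + 1))) ∧ ∃ᶠ k in atTop, ρ k ∈ Q.acc

/-- Finite paths from an initial state to `z`. -/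
def IsPrefix (Q : PBA Z) (z : Z) (l : List Z) : Prop :=
  (∃ z₀ ∈ Q.init, l.head? = some z₀) ∧ l.getLast? = some z ∧ l.IsChain Q.δ

/-- Cycles from `z` to `z` with at least one transition; `z` is listed at both ends. -/
def IsSuffix (Q : PBA Z) (z : Z) (l : List Z) : Prop :=
  l.head? = some z ∧ l.getLast? = some z ∧ 2 ≤ l.length ∧ l.IsChain Q.δ

/-- The sum of the weights along a finite path. -/
def cost (Q : PBA Z) : List Z → ℝ
  | a :: b :: l => Q.w a b + cost Q (b :: l)
  | _ => 0

end PBA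

/-! ### The planning algorithm -/

/-- `out` is what a correct shortest-path routine may return: a path of least cost among those
satisfying `feas`, or nothing if there is no path of least cost. -/
def IsShortest {Z : Type*} (feas : List Z → Prop) (cost : List Z → ℝ) :
    Option (List Z) → Prop
  | some l => feas l ∧ ∀ l', feas l' → cost l ≤ cost l'
  | none => ¬ ∃ l, feas l ∧ ∀ l', feas l' → cost l ≤ cost l'

/-- A prefix ending in an accepting state, a cycle through it, and the total cost. -/
structure Plan (Z : Type*) where
  acc : Z
  pre : List Z
  suf : List Z
  cost : ℝ

/-- The infinite path that runs through the prefix once and then through the cycle forever. -/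
def Plan.seq {Z : Type*} (π : Plan Z) (k : ℕ) : Z :=
  if k < π.pre.length then π.pre.getD k π.acc
  else π.suf.tail.getD ((k - π.pre.length) % π.suf.tail.length) π.acc

open Classical in
/-- The loop over the accepting states: `pre z` and `suf z` are the results of the shortest-path
computations for `z`, and the first plan of least total cost is kept. -/
noncomputable def planSearch {Z : Type*} (Q : PBA Z) (β : ℝ) (pre suf : Z → Option (List Z))
    (accs : List Z) : Option (Plan Z) :=
  accs.foldl (fun best z =>
    match pre z, suf z with
    | some l₁, some l₂ =>
      let J := β * Q.cost l₁ + (1 - β) * Q.cost l₂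
      match best with
      | none => some ⟨z, l₁, l₂, J⟩
      | some π => if J < π.cost then some ⟨z, l₁, l₂, J⟩ else some π
    | _, _ => best) none

/-! ### Motion segments and their concatenation -/

/-- A joint motion on `[0, tf]` with common crossing instant `tc`, for each real or copy agent. -/
structure Segment (M n m : ℕ) (κ : Type) where
  tc : ℝ
  tf : ℝ
  x : κ → Fin M → ℝ → Vec n
  u : κ → Fin M → ℝ → Vec m

/-- Every facet of `C` is guarded during `(a, b)`: either by the barrier inequality with rate `γ`
and slack `ε`, or by requiring directly that the facet is not met. -/
def Guarded {n m : ℕ} (D : Dynamics n m) (γ ε : ℝ) (C : Polytope n) (x : ℝ → Vec n)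
    (u : ℝ → Vec m) (a b : ℝ) : Prop :=
  ∀ j : Fin C.d,
    (∀ t ∈ Ico a b,
      -γ * (C.h j (x t) - ε) ≤ inner ℝ (C.normal j) (D.velocity (x t) (u t))) ∨
    (∀ t ∈ Ioo a b, 0 < C.h j (x t))

/-- The segment realizes a transition between (families of) global states `q` and `q'`. -/
structure Segment.Realizes {M n m p : ℕ} {κ : Type} (s : Segment M n m κ) (S : System M n m p)
    (γ ε : ℝ) (q q' : κ → Global M p) : Prop where
  tc_pos : 0 < s.tc
  tc_lt_tf : s.tc < s.tf
  continuous : ∀ c i, ContinuousOn (s.x c i) (Icc 0 s.tf)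
  solves_first : ∀ c i, (S.dyn i).SolvesOn (s.x c i) (s.u c i) (Ico 0 s.tc)
  solves_second : ∀ c i, (S.dyn i).SolvesOn (s.x c i) (s.u c i) (Ico s.tc s.tf)
  start : ∀ c i, s.x c i 0 = (S.cell (q c i)).centroid
  finish : ∀ c i, s.x c i s.tf = (S.cell (q' c i)).centroid
  crossing : ∀ c i, q c i ≠ q' c i →
    s.x c i s.tc ∈ (S.cell (q c i)).carrier ∩ (S.cell (q' c i)).carrier
  guard_first : ∀ c i,
    Guarded (S.dyn i) γ ε (S.cell (q c i)) (s.x c i) (s.u c i) 0 s.tc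
  guard_second : ∀ c i,
    Guarded (S.dyn i) γ ε (S.cell (q' c i)) (s.x c i) (s.u c i) s.tc s.tf

section Concatenation
variable {M n m : ℕ} {κ : Type}

/-- The time at which the `k`-th segment starts. -/
noncomputable def startTime (segs : ℕ → Segment M n m κ) (k : ℕ) : ℝ :=
  ∑ l ∈ Finset.range k, (segs l).tf

/-- Time `0` and the successive crossing instants of the concatenated motion. -/
noncomputable def stepTime (segs : ℕ → Segment M n m κ) : ℕ → ℝ
  | 0 => 0
  | k + 1 => startTime segs k + (segs k).tc

/-- The index of the segment that is active at time `t`. -/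
noncomputable def segIndex (segs : ℕ → Segment M n m κ) (t : ℝ) : ℕ :=
  sInf {k | t < startTime segs (k + 1)}

noncomputable def concatX (segs : ℕ → Segment M n m κ) (c : κ) (i : Fin M) (t : ℝ) : Vec n :=
  (segs (segIndex segs t)).x c i (t - startTime segs (segIndex segs t))

noncomputable def concatU (segs : ℕ → Segment M n m κ) (c : κ) (i : Fin M) (t : ℝ) : Vec m :=
  (segs (segIndex segs t)).u c i (t - startTime segs (segIndex segs t))

end Concatenation

/-! ### Properties of continuous trajectories -/

section Trajectories
variable {M n m p : ℕ}

/-- The trajectory on `[0, ∞)` is continuous, stays in the workspace, and solves the dynamics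
under the admissible, piecewise locally Lipschitz inputs `u`. -/
def DynamicallyFeasible (S : System M n m p) (x : Fin M → ℝ → Vec n) (u : Fin M → ℝ → Vec m) :
    Prop :=
  (∀ i, ContinuousOn (x i) (Ici 0)) ∧ (∀ i, ∀ t, 0 ≤ t → x i t ∈ S.P.carrier) ∧
    ∃ r : ℕ → ℝ, r 0 = 0 ∧ StrictMono r ∧ Tendsto r atTop atTop ∧
      ∀ k i, (S.dyn i).SolvesOn (x i) (u i) (Ico (r k) (r (k + 1)))

/-- At time `t` the region of the trajectory `x` is `j`. Adjacent regions share boundary points,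
so a trajectory that crosses a facet at time `t` counts as being in the region it enters. -/
def InRegion (S : System M n m p) (x : ℝ → Vec n) (t : ℝ) (j : Fin p) : Prop :=
  x t ∈ (S.cell j).carrier ∧ ∀ᶠ s in 𝓝[>] t, x s ∈ interior (S.cell j).carrier

/-- The trajectory follows the path `τ` with step instants `T`. -/
def Follows (S : System M n m p) (x : Fin M → ℝ → Vec n) (T : ℕ → ℝ) (τ : ℕ → Global M p) :
    Prop :=
  T 0 = 0 ∧ StrictMono T ∧ Tendsto T atTop atTop ∧
    ∀ k i, ∀ t ∈ Ico (T k) (T (k + 1)), InRegion S (x i) t (τ k i)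

/-- The times after `s` at which some agent is no longer in the region it occupies at `s`. -/
def changedAfter (f : Fin M → ℝ → Fin p) (s : ℝ) : Set ℝ := {t | s < t ∧ ∃ i, f i t ≠ f i s}

/-- `τ` is the global path induced by `x`: the sequence of the agents' regions at the successive
switching times `0 = s 0 < s 1 < ⋯` of all agents; the last global state is repeated if no agent
ever switches again. -/
def Induces (S : System M n m p) (x : Fin M → ℝ → Vec n) (τ : ℕ → Global M p) : Prop :=
  ∃ f : Fin M → ℝ → Fin p, (∀ i, ∀ t, 0 ≤ t → InRegion S (x i) t (f i t)) ∧
    ∃ s : ℕ → ℝ, s 0 = 0 ∧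
      (∀ k, ((changedAfter f (s k)).Nonempty ∧ s (k + 1) = sInf (changedAfter f (s k))) ∨
        (changedAfter f (s k) = ∅ ∧ s (k + 1) = s k)) ∧
      ∀ k i, τ k i = f i (s k)

/-- A step that leaves all agents in place occurs only if they stay in place forever after. -/
def NoIdleStep (τ : ℕ → Global M p) : Prop :=
  ∀ k, τ (k + 1) = τ k → ∀ l, k ≤ l → τ l = τ k

variable {AP : Fin M → Type*} {Y : Type*}

/-- `τ` is a global path that satisfies `φ` and the security constraints imposed. -/
def Meets (T : (i : Fin M) → AgentWTS p (AP i) Y) (φ : LTL (Σ i, AP i)) (sec : Security)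
    (τ : ℕ → Global M p) : Prop :=
  (gWTS T).IsPath τ ∧ φ.Sat (fun k => (gWTS T).L (τ k)) ∧
    (sec.imposesA → TypeASecure T τ) ∧ (sec.imposesB → TypeBSecure T τ)

end Trajectories

end SecurePlanning

open SecurePlanning

namespace SecurePlanning

/-! ### Accepting paths and least-cost plans -/

section Planning
variable {Z : Type*} {Q : PBA Z}

/-! The discrete half is a finiteness argument. On a finite product automaton an accepting path
visits one accepting state infinitely often, which yields a prefix and a cycle. Since `0 < M`,
transition weights have a positive lower bound, so only finitely many paths cost at most a given
amount and minima exist: the shortest-path routines cannot fail (`exists_plan_iff`). Conversely, a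
plan unrolls to an accepting path (`Plan.isAccepting_seq`). Optimality plays no role in the
properties of the plan. The formula holds because the automaton component is an accepting run;
security is built into the states of the abstraction.

The continuous half rests on `pos_of_barrier`: the barrier inequality with positive slack pushes a
trajectory that starts in a closed cell into its interior at once, even from a facet. Centroids are
interior, so segments glue there, and each step interval keeps every agent inside the prescribed
cell. Only finitely many distinct segments occur, so time diverges (`tendsto_startTime`).

Cell interiors are disjoint, so the region at each time is unique. Hence regions can change only at
crossing instants, and without idle steps the switching times recover the discrete path
(`Follows.eq_of_induces`). -/

theorem PBA.isPrefix_of_path {ρ : ℕ → Z} (h0 : ρ 0 ∈ Q.init)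
    (hρ : ∀ k, Q.δ (ρ k) (ρ (k + 1))) (k : ℕ) :
    Q.IsPrefix (ρ k) ((List.range (k + 1)).map ρ) := by
  refine ⟨⟨ρ 0, h0, ?_⟩, ?_, ?_⟩
  · simp [List.head?_range]
  · simp [List.getLast?_range]
  · rw [List.isChain_map, List.isChain_range_succ]
    exact fun m _ => hρ m

theorem PBA.isSuffix_of_path {ρ : ℕ → Z} (hρ : ∀ k, Q.δ (ρ k) (ρ (k + 1))) {j k : ℕ}
    (hk : 0 < k) (hjk : ρ (j + k) = ρ j) :
    Q.IsSuffix (ρ j) ((List.range (k + 1)).map fun l => ρ (j + l)) := by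
  refine ⟨?_, ?_, ?_, ?_⟩
  · simp [List.head?_range]
  · simp [List.getLast?_range, hjk]
  · simpa using Nat.succ_le_of_lt hk
  · rw [List.isChain_map, List.isChain_range_succ]
    exact fun m _ => hρ (j + m)

theorem PBA.IsAccepting.exists_prefix_suffix [Finite Z] {ρ : ℕ → Z} (h : Q.IsAccepting ρ) :
    ∃ z ∈ Q.acc, (∃ l, Q.IsPrefix z l) ∧ ∃ l, Q.IsSuffix z l := by
  obtain ⟨h0, hδ, hacc⟩ := h
  have : ∃ z, ∃ᶠ k in atTop, ρ k = z ∧ z ∈ Q.acc := by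
    by_contra hne
    have hall := eventually_all.2 fun z => not_frequently.1 (not_exists.1 hne z)
    obtain ⟨k, hk, hk'⟩ := (hacc.and_eventually hall).exists
    exact hk' _ ⟨rfl, hk⟩
  obtain ⟨z, hz⟩ := this
  obtain ⟨j, -, hj, hzacc⟩ := (frequently_atTop.1 hz) 0
  -- The second visit is strictly later, so the cycle has a transition.
  obtain ⟨k, hk, hkz, -⟩ := (frequently_atTop.1 hz) (j + 1)
  refine ⟨z, hzacc, ⟨_, hj ▸ isPrefix_of_path h0 hδ j⟩, ?_⟩
  have := isSuffix_of_path (j := j) (k := k - j) hδ (by omega)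
    (by rw [hj, Nat.add_sub_cancel' (by omega), hkz])
  exact ⟨_, hj ▸ this⟩

/-- A nonempty list has one transition fewer than it has states; for the empty list the left side is
`-c`, hence `0 ≤ c`. -/
theorem PBA.le_cost {c : ℝ} (hc : 0 ≤ c) (hw : ∀ z z', c ≤ Q.w z z') :
    ∀ l : List Z, c * ((l.length : ℝ) - 1) ≤ Q.cost l
  | [] => by simpa [PBA.cost] using hc
  | [_] => by simp [PBA.cost]
  | a :: b :: l => by
    have := PBA.le_cost hc hw (b :: l)
    have := hw a b
    simp only [PBA.cost, List.length_cons, Nat.cast_add, Nat.cast_one] at *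
    nlinarith

/-- Lists no dearer than a fixed feasible one have bounded length, so they are finitely many over a
finite alphabet. -/
theorem PBA.exists_least_cost [Finite Z] {c : ℝ} (hc : 0 < c) (hw : ∀ z z', c ≤ Q.w z z')
    {feas : List Z → Prop} (h : ∃ l, feas l) :
    ∃ l, feas l ∧ ∀ l', feas l' → Q.cost l ≤ Q.cost l' := by
  obtain ⟨l₀, h₀⟩ := h
  obtain ⟨N, hN⟩ := exists_nat_ge (Q.cost l₀ / c + 1)
  have hfin : {l | feas l ∧ Q.cost l ≤ Q.cost l₀}.Finite := by
    refine (List.finite_length_le Z N).subset fun l hl => ?_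
    have h1 := (le_cost hc.le hw l).trans hl.2
    rw [mul_comm, ← le_div_iff₀ hc] at h1
    exact_mod_cast (show (l.length : ℝ) ≤ N by linarith)
  obtain ⟨l, hl, hmin⟩ := exists_min_image _ Q.cost hfin ⟨l₀, h₀, le_rfl⟩
  refine ⟨l, hl.1, fun l' hl' => ?_⟩
  by_cases hle : Q.cost l' ≤ Q.cost l₀
  · exact hmin l' ⟨hl', hle⟩
  · exact hl.2.trans (le_of_not_ge hle)

theorem IsShortest.exists_some {feas : List Z → Prop} {cost : List Z → ℝ}
    {o : Option (List Z)} (ho : IsShortest feas cost o)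
    (h : ∃ l, feas l ∧ ∀ l', feas l' → cost l ≤ cost l') : ∃ l, o = some l := by
  cases o with
  | none => exact absurd h ho
  | some l => exact ⟨l, rfl⟩

theorem planSearch_some {β : ℝ} {pre suf : Z → Option (List Z)} {accs : List Z} {π : Plan Z}
    (h : planSearch Q β pre suf accs = some π) :
    π.acc ∈ accs ∧ pre π.acc = some π.pre ∧ suf π.acc = some π.suf := by
  classical
  -- A loop invariant for an arbitrary step function; the cost comparison is irrelevant to it.
  have key : ∀ (l : List Z) (step : Option (Plan Z) → Z → Option (Plan Z))
      (P : Plan Z → Prop) (_ : ∀ best z π, z ∈ l → (∀ π', best = some π' → P π') →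
        step best z = some π → P π) (b : Option (Plan Z)) (_ : ∀ π', b = some π' → P π')
      (π), l.foldl step b = some π → P π := by
    intro l step P
    induction l with
    | nil => intro _ b hb π hπ; exact hb π hπ
    | cons a l ih =>
      intro hs b hb π hπ
      refine ih (fun best z π hz => hs best z π (List.mem_cons_of_mem _ hz)) (step b a) ?_ π hπ
      exact fun π' hπ' => hs b a π' List.mem_cons_self hb hπ'
  refine key accs _ (fun π => π.acc ∈ accs ∧ pre π.acc = some π.pre ∧ suf π.acc = some π.suf)
    ?_ none (by simp) π h
  intro best z π hz hb hs
  dsimp only at hs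
  split at hs
  · rename_i l₁ l₂ h₁ h₂
    split at hs
    · cases hs
      exact ⟨hz, h₁, h₂⟩
    · split_ifs at hs
      · cases hs
        exact ⟨hz, h₁, h₂⟩
      · exact hb _ hs
  · exact hb _ hs

theorem exists_planSearch {β : ℝ} {pre suf : Z → Option (List Z)} {accs : List Z} {z : Z}
    (hz : z ∈ accs) (hpre : ∃ l, pre z = some l) (hsuf : ∃ l, suf z = some l) :
    ∃ π, planSearch Q β pre suf accs = some π := by
  classical
  obtain ⟨l₁, h₁⟩ := hpre
  obtain ⟨l₂, h₂⟩ := hsuf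
  -- The loop never discards a plan without replacing it, and it holds one after processing `z`.
  have key : ∀ (l : List Z) (step : Option (Plan Z) → Z → Option (Plan Z))
      (_ : ∀ b a, b.isSome → (step b a).isSome) (_ : ∀ b, (step b z).isSome)
      (b : Option (Plan Z)), (z ∈ l ∨ b.isSome) → (l.foldl step b).isSome := by
    intro l step hs hzs
    induction l with
    | nil => intro b hb; simpa using hb
    | cons a l ih =>
      intro b hb
      refine ih (step b a) ?_
      rcases hb with hb | hb
      · rcases List.mem_cons.1 hb with rfl | hb
        · exact Or.inr (hzs b)
        · exact Or.inl hb
      · exact Or.inr (hs b a hb)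
  refine Option.isSome_iff_exists.1 (key accs _ ?_ ?_ none (Or.inl hz))
  · intro b a hb
    dsimp only
    split
    · split
      · rfl
      · split_ifs <;> rfl
    · exact hb
  · intro b
    rw [h₁, h₂]
    dsimp only
    split
    · rfl
    · split_ifs <;> rfl

theorem Plan.isAccepting_seq {π : Plan Z} (hacc : π.acc ∈ Q.acc)
    (hpre : Q.IsPrefix π.acc π.pre) (hsuf : Q.IsSuffix π.acc π.suf) :
    Q.IsAccepting π.seq := by
  obtain ⟨z, p, s, J⟩ := π
  obtain ⟨⟨z₀, hz₀, hhead⟩, hlast, hchain⟩ := hpre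
  obtain ⟨shead, slast, slen, schain⟩ := hsuf
  dsimp only at *
  obtain ⟨y, s, rfl⟩ : ∃ y t, s = y :: t := by
    cases s with
    | nil => simp at slen
    | cons y t => exact ⟨y, t, rfl⟩
  obtain rfl : y = z := by simpa using shead
  have hb : 0 < s.length := by simp only [List.length_cons] at slen; omega
  have ha : 0 < p.length := by
    rw [List.length_pos_iff]; rintro rfl; simp at hhead
  rw [List.isChain_iff_getElem] at hchain schain
  have p0 : p[0] = z₀ := by
    rw [List.head?_eq_getElem?, List.getElem?_eq_getElem ha] at hhead
    exact Option.some.inj hhead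
  have pl : p[p.length - 1] = y := by
    rw [List.getLast?_eq_getElem?, List.getElem?_eq_getElem (by omega)] at hlast
    exact Option.some.inj hlast
  -- The cycle lists `y` at both ends, so its tail, the block repeated by `Plan.seq`, again ends in
  -- `y`.
  have sl : s[s.length - 1] = y := by
    rw [List.getLast?_eq_getElem?, List.getElem?_eq_getElem (by simp)] at slast
    have := Option.some.inj slast
    simp only [List.length_cons, Nat.add_sub_cancel] at this
    rw [← this, List.getElem_cons]
    simp [hb.ne']
  have s0 : Q.δ y s[0] := by simpa using schain 0 (by simpa using hb)
  have sδ : ∀ i (h : i + 1 < s.length), Q.δ s[i] s[i + 1] := fun i h =>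
    schain (i + 1) (by simpa using h)
  have seq_lt : ∀ k (h : k < p.length), Plan.seq ⟨y, p, y :: s, J⟩ k = p[k] := fun k h => by
    simp [Plan.seq, h]
  have seq_ge : ∀ k (_ : p.length ≤ k), Plan.seq ⟨y, p, y :: s, J⟩ k =
      s[(k - p.length) % s.length]'(Nat.mod_lt _ hb) := fun k h => by
    simp [Plan.seq, not_lt.2 h, Nat.mod_lt _ hb]
  refine ⟨?_, fun k => ?_, ?_⟩
  · rw [seq_lt 0 ha, p0]
    exact hz₀
  · rcases lt_trichotomy (k + 1) p.length with h | h | h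
    · rw [seq_lt k (by omega), seq_lt (k + 1) h]
      exact hchain k h
    · rw [seq_lt k (by omega), seq_ge (k + 1) h.ge]
      have h1 : p[k]'(by omega) = y := by rw [← pl]; congr 1; omega
      simpa [h1, h] using s0
    · rw [seq_ge k (by omega), seq_ge (k + 1) (by omega)]
      have hlt := Nat.mod_lt (k - p.length) hb
      have hmod : (k + 1 - p.length) % s.length =
          ((k - p.length) % s.length + 1) % s.length := by
        rw [Nat.mod_add_mod]; congr 1; omega
      simp only [hmod]
      rcases Nat.lt_or_ge ((k - p.length) % s.length + 1) s.length with h' | h'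
      · simp only [Nat.mod_eq_of_lt h']
        exact sδ _ h'
      · have he : (k - p.length) % s.length = s.length - 1 := by omega
        simp only [he, Nat.sub_add_cancel hb, Nat.mod_self, sl]
        exact s0
  -- This index is the last position of the repetition numbered `N`, where the path is at the
  -- accepting state.
  · refine frequently_atTop.2 fun N => ⟨p.length + (s.length - 1 + s.length * N), ?_, ?_⟩
    · nlinarith
    · rw [seq_ge _ (by omega)]
      simp only [Nat.add_sub_cancel_left, Nat.add_mul_mod_self_left,
        Nat.mod_eq_of_lt (Nat.sub_lt hb one_pos), sl]
      exact hacc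

end Planning

end SecurePlanning

namespace SecurePlanning

/-! ### Polytopes and guarded trajectories -/

namespace Polytope
variable {n : ℕ} (C : Polytope n)

theorem continuous_h (j : Fin C.d) : Continuous (C.h j) := by
  unfold h
  fun_prop

theorem isClosed_carrier : IsClosed C.carrier := by
  have : C.carrier = ⋂ j, {x | 0 ≤ C.h j x} := by ext; simp [carrier]
  rw [this]
  exact isClosed_iInter fun j => isClosed_le continuous_const (C.continuous_h j)

/-- An interior point can be moved slightly against a normal without leaving the polytope; as the
normal is nonzero, this strictly decreases `h`. -/
theorem mem_interior_carrier {x : Vec n} : x ∈ interior C.carrier ↔ ∀ j, 0 < C.h j x := by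
  constructor
  · intro hx j
    have hcont : Tendsto (fun s : ℝ => x - s • C.normal j) (𝓝[>] 0) (𝓝 x) := by
      have : Continuous fun s : ℝ => x - s • C.normal j := by fun_prop
      simpa using (this.tendsto 0).mono_left nhdsWithin_le_nhds
    obtain ⟨s, hs, hs0⟩ := ((hcont.eventually (isOpen_interior.mem_nhds hx)).and
      self_mem_nhdsWithin).exists
    have h1 : 0 ≤ C.h j (x - s • C.normal j) := interior_subset hs j
    have h2 : 0 < inner ℝ (C.normal j) (C.normal j) :=
      real_inner_self_pos.2 (C.normal_ne_zero j)
    have h3 : C.h j (x - s • C.normal j) = C.h j x - s * inner ℝ (C.normal j) (C.normal j) := by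
      simp only [h, inner_sub_right, inner_smul_right]; ring
    have := mul_pos (mem_Ioi.1 hs0) h2
    linarith
  · intro hx
    have hopen : IsOpen (⋂ j, {x | 0 < C.h j x}) :=
      isOpen_iInter_of_finite fun j => isOpen_lt continuous_const (C.continuous_h j)
    refine interior_maximal (fun y hy j => ?_) hopen (mem_iInter.2 hx)
    exact (mem_iInter.1 hy j).le

theorem isCompact_carrier : IsCompact C.carrier :=
  Metric.isCompact_of_isClosed_isBounded C.isClosed_carrier C.bounded

theorem interior_carrier_nonempty : (interior C.carrier).Nonempty := C.full_dim

/-- As `h` is affine, its value at the centroid is its average over the polytope, where it is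
nonnegative, and positive on the interior, a set of positive measure. -/
theorem h_centroid_pos (j : Fin C.d) : 0 < C.h j C.centroid := by
  have hfin : volume C.carrier ≠ ⊤ := C.isCompact_carrier.measure_ne_top
  have hint0 : 0 < volume (interior C.carrier) :=
    isOpen_interior.measure_pos volume C.interior_carrier_nonempty
  have hpos : 0 < volume.real C.carrier :=
    ENNReal.toReal_pos (hint0.trans_le (measure_mono interior_subset)).ne' hfin
  have hid : IntegrableOn (fun x : Vec n => x) C.carrier volume :=
    continuous_id.continuousOn.integrableOn_compact C.isCompact_carrier
  have hh : IntegrableOn (C.h j) C.carrier volume :=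
    (C.continuous_h j).continuousOn.integrableOn_compact C.isCompact_carrier
  have hI : 0 < ∫ x in C.carrier, C.h j x := by
    rw [setIntegral_pos_iff_support_of_nonneg_ae
      (ae_restrict_of_forall_mem C.isClosed_carrier.measurableSet fun x hx => hx j) hh]
    refine hint0.trans_le (measure_mono fun x hx => ⟨?_, interior_subset hx⟩)
    exact (C.mem_interior_carrier.1 hx j).ne'
  have hsum : ∫ x in C.carrier, C.h j x =
      inner ℝ (C.normal j) (∫ x in C.carrier, x) + volume.real C.carrier * C.offset j := by
    simp only [h]
    have h1 : Integrable (fun x : Vec n => inner ℝ (C.normal j) x)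
        (volume.restrict C.carrier) := Integrable.const_inner (𝕜 := ℝ) (C.normal j) hid
    have h2 : Integrable (fun _ : Vec n => C.offset j) (volume.restrict C.carrier) :=
      integrableOn_const hfin
    rw [integral_add h1 h2,
      integral_inner hid, setIntegral_const, smul_eq_mul]
  have hc : C.h j C.centroid = (volume.real C.carrier)⁻¹ * ∫ x in C.carrier, C.h j x := by
    rw [hsum, h, centroid, setAverage_eq, inner_smul_right]
    field_simp
  rw [hc]
  positivity

theorem centroid_mem_interior : C.centroid ∈ interior C.carrier :=
  C.mem_interior_carrier.2 C.h_centroid_pos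

end Polytope

/-- A function on `[a, b)` that starts at a nonnegative value and satisfies the barrier inequality
with positive rate and slack is positive afterwards. -/
theorem pos_of_barrier {γ ε a b : ℝ} (hγ : 0 < γ) (hε : 0 < ε) {g g' : ℝ → ℝ}
    (hg : ∀ t ∈ Ico a b, HasDerivWithinAt g (g' t) (Ico a b) t)
    (hbar : ∀ t ∈ Ico a b, -γ * (g t - ε) ≤ g' t) (ha : 0 ≤ g a) :
    ∀ t ∈ Ioo a b, 0 < g t := by
  intro t ht
  have hd : ∀ s ∈ Ico a b, HasDerivWithinAt (fun s => (g s - ε) * Real.exp (γ * s))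
      (g' s * Real.exp (γ * s) + (g s - ε) * (Real.exp (γ * s) * γ)) (Ico a b) s := by
    intro s hs
    have he : HasDerivAt (fun s : ℝ => Real.exp (γ * s)) (Real.exp (γ * s) * γ) s := by
      simpa using ((hasDerivAt_id s).const_mul γ).exp
    exact ((hg s hs).sub_const ε).mul he.hasDerivWithinAt
  -- The integrating factor turns the barrier inequality into monotonicity.
  have hmono : MonotoneOn (fun s => (g s - ε) * Real.exp (γ * s)) (Ico a b) := by
    refine monotoneOn_of_hasDerivWithinAt_nonneg (convex_Ico a b)
      (fun s hs => (hd s hs).continuousWithinAt)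
      (fun s hs => (hd s (interior_subset hs)).mono interior_subset) fun s hs => ?_
    have := hbar s (interior_subset hs)
    have he := Real.exp_pos (γ * s)
    nlinarith
  have hle : (g a - ε) * Real.exp (γ * a) ≤ (g t - ε) * Real.exp (γ * t) :=
    hmono ⟨le_rfl, ht.1.trans ht.2⟩ ⟨ht.1.le, ht.2⟩ ht.1.le
  have hlt : Real.exp (γ * a) < Real.exp (γ * t) :=
    Real.exp_lt_exp.2 (mul_lt_mul_of_pos_left ht.1 hγ)
  have hpa := Real.exp_pos (γ * a)
  have hpt := Real.exp_pos (γ * t)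
  -- If `g t ≤ 0`, the product at `t` is at most `-ε * exp (γ * t)`, strictly below `-ε * exp (γ *
  -- a)`, which bounds the product at `a` from below.
  by_contra! hneg
  nlinarith [mul_nonneg ha hpa.le, mul_nonneg (neg_nonneg.2 hneg) hpt.le]

/-! ### Guarded motion inside a cell -/

section Guarded
variable {n m : ℕ} {D : Dynamics n m} {γ ε : ℝ} {C : Polytope n} {x : ℝ → Vec n}
  {u : ℝ → Vec m} {a b : ℝ}

theorem Guarded.mem_interior (hG : Guarded D γ ε C x u a b) (hγ : 0 < γ) (hε : 0 < ε)
    (hx : D.SolvesOn x u (Ico a b)) (ha : x a ∈ C.carrier) :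
    ∀ t ∈ Ioo a b, x t ∈ interior C.carrier := by
  intro t ht
  refine C.mem_interior_carrier.2 fun j => ?_
  rcases hG j with hbar | hpos
  · refine pos_of_barrier (g := fun t => C.h j (x t)) hγ hε (fun s hs => ?_) hbar (ha j) t ht
    have h1 := ((innerSL ℝ (C.normal j)).hasFDerivAt.comp_hasDerivWithinAt s
      (hx.2 s hs).2).add_const (C.offset j)
    simpa [Function.comp_def, Polytope.h] using h1
  · exact hpos t ht

theorem Guarded.mem_carrier (hG : Guarded D γ ε C x u a b) (hγ : 0 < γ) (hε : 0 < ε)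
    (hab : a < b) (hx : D.SolvesOn x u (Ico a b)) (hc : ContinuousOn x (Icc a b))
    (ha : x a ∈ C.carrier) : ∀ t ∈ Icc a b, x t ∈ C.carrier := by
  -- The dynamics are not assumed at `b`; continuity carries the closed condition there.
  have hm : MapsTo x (Ioo a b) C.carrier := fun t ht =>
    interior_subset (hG.mem_interior hγ hε hx ha t ht)
  have := MapsTo.closure_of_continuousOn hm (by rwa [closure_Ioo hab.ne])
  rwa [closure_Ioo hab.ne, C.isClosed_carrier.closure_eq] at this

end Guarded

end SecurePlanning

namespace SecurePlanning

/-! ### Segments and their concatenation -/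

theorem Dynamics.SolvesOn.shift {n m : ℕ} {D : Dynamics n m} {x y : ℝ → Vec n}
    {u v : ℝ → Vec m} {a b s : ℝ} (h : D.SolvesOn x u (Ico a b))
    (hy : ∀ t ∈ Ico (s + a) (s + b), y t = x (t - s))
    (hv : ∀ t ∈ Ico (s + a) (s + b), v t = u (t - s)) :
    D.SolvesOn y v (Ico (s + a) (s + b)) := by
  have hmaps : MapsTo (fun t => t - s) (Ico (s + a) (s + b)) (Ico a b) := fun t ht =>
    ⟨by linarith [ht.1], by linarith [ht.2]⟩
  refine ⟨fun t ht => ?_, fun t ht => ⟨?_, ?_⟩⟩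
  · obtain ⟨K, N, hN, hK⟩ := h.1 (hmaps ht)
    have htend : Tendsto (fun t => t - s) (𝓝[Ico (s + a) (s + b)] t) (𝓝[Ico a b] (t - s)) :=
      (continuous_sub_right s).continuousWithinAt.tendsto_nhdsWithin hmaps
    refine ⟨K, _, inter_mem (htend hN) self_mem_nhdsWithin, ?_⟩
    rintro t₁ ⟨h₁, h₁'⟩ t₂ ⟨h₂, h₂'⟩
    rw [hv _ h₁', hv _ h₂']
    simpa using hK h₁ h₂
  · rw [hv t ht]
    exact (h.2 _ (hmaps ht)).1
  · have hd := (h.2 _ (hmaps ht)).2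
    rw [hy t ht, hv t ht]
    have hd' := hd.scomp t ((hasDerivAt_id t).sub_const s).hasDerivWithinAt hmaps
    rw [one_smul] at hd'
    exact hd'.congr hy (hy t ht)

theorem exists_mem_Ico_of_tendsto {T : ℕ → ℝ} (h0 : T 0 = 0) (hT : Tendsto T atTop atTop)
    {t : ℝ} (ht : 0 ≤ t) : ∃ k, t ∈ Ico (T k) (T (k + 1)) := by
  classical
  have hex : ∃ k, t < T k := (hT.eventually_gt_atTop t).exists
  obtain ⟨k, hk⟩ : ∃ k, Nat.find hex = k + 1 :=
    Nat.exists_eq_succ_of_ne_zero fun h => by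
      have := Nat.find_spec hex
      rw [h, h0] at this
      linarith
  exact ⟨k, not_lt.1 (Nat.find_min hex (by omega)), hk ▸ Nat.find_spec hex⟩

section Segments
variable {M n m p : ℕ} {κ : Type} {S : System M n m p} {γ ε : ℝ}

theorem System.cell_subset (S : System M n m p) (j : Fin p) :
    (S.cell j).carrier ⊆ S.P.carrier := by
  rw [S.cover]
  exact subset_iUnion (fun j => (S.cell j).carrier) j

namespace Segment.Realizes
variable {s : Segment M n m κ} {q q' : κ → Global M p}

theorem tf_pos (h : s.Realizes S γ ε q q') : 0 < s.tf := h.tc_pos.trans h.tc_lt_tf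

theorem start_mem (h : s.Realizes S γ ε q q') (c : κ) (i : Fin M) :
    s.x c i 0 ∈ interior (S.cell (q c i)).carrier := by
  rw [h.start]
  exact Polytope.centroid_mem_interior _

theorem mem_interior_first (h : s.Realizes S γ ε q q') (hγ : 0 < γ) (hε : 0 < ε) (c : κ)
    (i : Fin M) : ∀ t ∈ Ico 0 s.tc, s.x c i t ∈ interior (S.cell (q c i)).carrier := by
  intro t ht
  rcases ht.1.eq_or_lt with rfl | h0
  · exact h.start_mem c i
  · exact (h.guard_first c i).mem_interior hγ hε (h.solves_first c i)
      (interior_subset (h.start_mem c i)) t ⟨h0, ht.2⟩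

/-- This supplies the initial condition for the second guard. Agents that change region get it from
the crossing condition, the others from the first guard. -/
theorem mem_carrier_tc (h : s.Realizes S γ ε q q') (hγ : 0 < γ) (hε : 0 < ε) (c : κ)
    (i : Fin M) : s.x c i s.tc ∈ (S.cell (q' c i)).carrier := by
  by_cases hq : q c i = q' c i
  · rw [← hq]
    exact (h.guard_first c i).mem_carrier hγ hε h.tc_pos (h.solves_first c i)
      ((h.continuous c i).mono (Icc_subset_Icc_right h.tc_lt_tf.le))
      (interior_subset (h.start_mem c i)) s.tc ⟨h.tc_pos.le, le_rfl⟩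
  · exact (h.crossing c i hq).2

theorem mem_interior_second (h : s.Realizes S γ ε q q') (hγ : 0 < γ) (hε : 0 < ε) (c : κ)
    (i : Fin M) : ∀ t ∈ Ioc s.tc s.tf, s.x c i t ∈ interior (S.cell (q' c i)).carrier := by
  intro t ht
  rcases ht.2.eq_or_lt with rfl | h1
  · rw [h.finish]
    exact Polytope.centroid_mem_interior _
  · exact (h.guard_second c i).mem_interior hγ hε (h.solves_second c i)
      (h.mem_carrier_tc hγ hε c i) t ⟨ht.1, h1⟩

theorem mem_workspace (h : s.Realizes S γ ε q q') (hγ : 0 < γ) (hε : 0 < ε) (c : κ)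
    (i : Fin M) : ∀ t ∈ Icc 0 s.tf, s.x c i t ∈ S.P.carrier := by
  intro t ht
  rcases lt_trichotomy t s.tc with h1 | rfl | h1
  · exact S.cell_subset _ (interior_subset (h.mem_interior_first hγ hε c i t ⟨ht.1, h1⟩))
  · exact S.cell_subset _ (h.mem_carrier_tc hγ hε c i)
  · exact S.cell_subset _ (interior_subset (h.mem_interior_second hγ hε c i t ⟨h1, ht.2⟩))

end Segment.Realizes

variable {segs : ℕ → Segment M n m κ} {path : ℕ → κ → Global M p}

@[simp] theorem startTime_zero : startTime segs 0 = 0 := by simp [startTime]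

theorem startTime_succ (k : ℕ) : startTime segs (k + 1) = startTime segs k + (segs k).tf :=
  Finset.sum_range_succ _ _

variable (hR : ∀ k, (segs k).Realizes S γ ε (path k) (path (k + 1)))
include hR

theorem startTime_strictMono : StrictMono (startTime segs) :=
  strictMono_nat_of_lt_succ fun k => by
    rw [startTime_succ]
    linarith [(hR k).tf_pos]

theorem segIndex_eq {k : ℕ} {t : ℝ} (ht : t ∈ Ico (startTime segs k) (startTime segs (k + 1))) :
    segIndex segs t = k := by
  refine le_antisymm (Nat.sInf_le ht.2) (le_csInf ⟨k, ht.2⟩ fun l hl => ?_)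
  have : startTime segs k < startTime segs (l + 1) := ht.1.trans_lt hl
  have := (startTime_strictMono hR).lt_iff_lt.1 this
  omega

theorem concatU_eq {k : ℕ} {t : ℝ} (ht : t ∈ Ico (startTime segs k) (startTime segs (k + 1)))
    (c : κ) (i : Fin M) : concatU segs c i t = (segs k).u c i (t - startTime segs k) := by
  rw [concatU, segIndex_eq hR ht]

theorem concatX_startTime (c : κ) (k : ℕ) (i : Fin M) :
    concatX segs c i (startTime segs k) = (S.cell (path k c i)).centroid := by
  rw [concatX, segIndex_eq hR ⟨le_rfl, startTime_strictMono hR k.lt_succ_self⟩, sub_self,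
    (hR k).start]

/-- The right endpoint is allowed because consecutive segments meet at a common centroid; inputs may
jump there, so `concatU_eq` is half-open. -/
theorem concatX_eq {k : ℕ} {t : ℝ} (ht : t ∈ Icc (startTime segs k) (startTime segs (k + 1)))
    (c : κ) (i : Fin M) : concatX segs c i t = (segs k).x c i (t - startTime segs k) := by
  rcases ht.2.eq_or_lt with rfl | h
  · rw [concatX_startTime hR, startTime_succ, add_sub_cancel_left, (hR k).finish]
  · rw [concatX, segIndex_eq hR ⟨ht.1, h⟩]

theorem stepTime_lt_succ (k : ℕ) : stepTime segs k < stepTime segs (k + 1) := by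
  cases k with
  | zero => simpa [stepTime] using (hR 0).tc_pos
  | succ k =>
    have h1 := (hR k).tc_lt_tf
    have h2 := (hR (k + 1)).tc_pos
    simp only [stepTime, startTime_succ]
    linarith

theorem concatX_mem_interior (hγ : 0 < γ) (hε : 0 < ε) (c : κ) (i : Fin M) (k : ℕ) {t : ℝ}
    (ht : t ∈ Ioo (stepTime segs k) (stepTime segs (k + 1))) :
    concatX segs c i t ∈ interior (S.cell (path k c i)).carrier := by
  have hfirst : ∀ k, ∀ t ∈ Ico (startTime segs k) (startTime segs k + (segs k).tc),
      concatX segs c i t ∈ interior (S.cell (path k c i)).carrier := by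
    intro k t ht
    have := (hR k).tc_lt_tf
    rw [concatX_eq hR ⟨ht.1, by rw [startTime_succ]; linarith [ht.2]⟩]
    exact (hR k).mem_interior_first hγ hε c i _ ⟨by linarith [ht.1], by linarith [ht.2]⟩
  cases k with
  | zero =>
    refine hfirst 0 t ⟨?_, ht.2⟩
    rw [startTime_zero]
    exact ht.1.le
  | succ k =>
    -- A later step interval joins the second phase of one segment to the first phase of the next;
    -- both are guarded by the same cell.
    rcases le_or_gt t (startTime segs (k + 1)) with h | h
    · have h1 : startTime segs k + (segs k).tc < t := ht.1
      have := (hR k).tc_pos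
      rw [concatX_eq hR ⟨by linarith, h⟩]
      rw [startTime_succ] at h
      exact (hR k).mem_interior_second hγ hε c i _ ⟨by linarith, by linarith⟩
    · exact hfirst (k + 1) t ⟨h.le, ht.2⟩

theorem concatX_stepTime_mem (hγ : 0 < γ) (hε : 0 < ε) (c : κ) (i : Fin M) (k : ℕ) :
    concatX segs c i (stepTime segs k) ∈ (S.cell (path k c i)).carrier := by
  cases k with
  | zero =>
    have := concatX_startTime hR c 0 i
    rw [startTime_zero] at this
    rw [stepTime, this]
    exact interior_subset (Polytope.centroid_mem_interior _)
  | succ k =>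
    have h1 := (hR k).tc_lt_tf
    have h2 := (hR k).tc_pos
    rw [stepTime, concatX_eq hR ⟨by linarith, by rw [startTime_succ]; linarith⟩,
      add_sub_cancel_left]
    exact (hR k).mem_carrier_tc hγ hε c i

variable (hT : Tendsto (startTime segs) atTop atTop)
include hT

theorem follows_concatX (hγ : 0 < γ) (hε : 0 < ε) (c : κ) :
    Follows S (concatX segs c) (stepTime segs) (fun k => path k c) := by
  refine ⟨rfl, strictMono_nat_of_lt_succ (stepTime_lt_succ hR), ?_, fun k i t ht => ⟨?_, ?_⟩⟩
  · refine (tendsto_add_atTop_iff_nat 1).1 (tendsto_atTop_mono (fun k => ?_) hT)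
    simpa [stepTime] using (hR k).tc_pos.le
  · rcases ht.1.eq_or_lt with rfl | h
    · exact concatX_stepTime_mem hR hγ hε c i k
    · exact interior_subset (concatX_mem_interior hR hγ hε c i k ⟨h, ht.2⟩)
  · filter_upwards [Ioo_mem_nhdsGT ht.2] with s hs
    exact concatX_mem_interior hR hγ hε c i k ⟨ht.1.trans_lt hs.1, hs.2⟩

theorem continuousOn_concatX (c : κ) (i : Fin M) : ContinuousOn (concatX segs c i) (Ici 0) := by
  have hmono := startTime_strictMono hR
  have hseg : ∀ k, ContinuousOn (concatX segs c i)
      (Icc (startTime segs k) (startTime segs (k + 1))) := by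
    intro k
    refine ContinuousOn.congr (f := fun t => (segs k).x c i (t - startTime segs k)) ?_
      fun t ht => concatX_eq hR ht c i
    refine ((hR k).continuous c i).comp (continuous_sub_right _).continuousOn fun t ht => ?_
    rw [startTime_succ] at ht
    exact ⟨by linarith [ht.1], by linarith [ht.2]⟩
  have hfin : ∀ k, ContinuousOn (concatX segs c i) (Icc 0 (startTime segs k)) := by
    intro k
    induction k with
    | zero => simp
    | succ k ih =>
      have h0 : 0 ≤ startTime segs k := by
        simpa using hmono.monotone (Nat.zero_le k)
      rw [← Icc_union_Icc_eq_Icc h0 (hmono k.lt_succ_self).le]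
      exact ih.union_of_isClosed (hseg k) isClosed_Icc isClosed_Icc
  intro t ht
  obtain ⟨k, hk⟩ := (hT.eventually_gt_atTop t).exists
  refine (hfin k t ⟨ht, hk.le⟩).mono_of_mem_nhdsWithin ?_
  filter_upwards [self_mem_nhdsWithin, mem_nhdsWithin_of_mem_nhds (Iio_mem_nhds hk)] with s h1 h2
  exact ⟨h1, le_of_lt h2⟩

theorem dynamicallyFeasible_concat (hγ : 0 < γ) (hε : 0 < ε) (c : κ) :
    DynamicallyFeasible S (concatX segs c) (concatU segs c) := by
  have hmono := startTime_strictMono hR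
  refine ⟨continuousOn_concatX hR hT c, fun i t ht => ?_, ?_⟩
  · obtain ⟨k, hk⟩ := exists_mem_Ico_of_tendsto startTime_zero hT ht
    rw [concatX_eq hR ⟨hk.1, hk.2.le⟩]
    rw [startTime_succ] at hk
    exact (hR k).mem_workspace hγ hε c i _ ⟨by linarith [hk.1], by linarith [hk.2]⟩
  -- Even indices are segment starts and odd ones crossing instants, the only times at which inputs
  -- may jump. The `+ 0` below matches the form of `SolvesOn.shift`.
  · set r : ℕ → ℝ := fun j => startTime segs (j / 2) + (j % 2 : ℕ) * (segs (j / 2)).tc with hr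
    have heven : ∀ k, r (2 * k) = startTime segs k + 0 := fun k => by simp [hr]
    have hodd : ∀ k, r (2 * k + 1) = startTime segs k + (segs k).tc := fun k => by
      simp [hr, Nat.mul_add_div]
    have hnext : ∀ k, r (2 * k + 1 + 1) = startTime segs k + (segs k).tf := fun k => by
      rw [show 2 * k + 1 + 1 = 2 * (k + 1) by ring, heven, startTime_succ, add_zero]
    have hstep : ∀ j, r j < r (j + 1) := by
      intro j
      rcases Nat.even_or_odd' j with ⟨k, rfl | rfl⟩
      · rw [heven, hodd]
        linarith [(hR k).tc_pos]
      · rw [hodd, hnext]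
        linarith [(hR k).tc_lt_tf]
    have hrm := strictMono_nat_of_lt_succ hstep
    refine ⟨r, by simp [hr], hrm, ?_, fun j i => ?_⟩
    · refine tendsto_atTop_atTop_of_monotone hrm.monotone fun b => ?_
      obtain ⟨k, hk⟩ := (hT.eventually_ge_atTop b).exists
      exact ⟨2 * k, by rwa [heven, add_zero]⟩
    · rcases Nat.even_or_odd' j with ⟨k, rfl | rfl⟩
      · rw [heven, hodd]
        have := (hR k).tc_lt_tf
        have hsub : ∀ t ∈ Ico (startTime segs k + 0) (startTime segs k + (segs k).tc),
            t ∈ Ico (startTime segs k) (startTime segs (k + 1)) := fun t ht => by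
          rw [startTime_succ]
          exact ⟨by linarith [ht.1], by linarith [ht.2]⟩
        exact ((hR k).solves_first c i).shift
          (fun t ht => concatX_eq hR (Ico_subset_Icc_self (hsub t ht)) c i)
          fun t ht => concatU_eq hR (hsub t ht) c i
      · rw [hodd, hnext]
        have := (hR k).tc_pos
        have hsub : ∀ t ∈ Ico (startTime segs k + (segs k).tc) (startTime segs k + (segs k).tf),
            t ∈ Ico (startTime segs k) (startTime segs (k + 1)) := fun t ht => by
          rw [startTime_succ]
          exact ⟨by linarith [ht.1], by linarith [ht.2]⟩
        exact ((hR k).solves_second c i).shift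
          (fun t ht => concatX_eq hR (Ico_subset_Icc_self (hsub t ht)) c i)
          fun t ht => concatU_eq hR (hsub t ht) c i

end Segments

/-! ### The path induced by a trajectory -/

section Induced
variable {M n m p : ℕ} {S : System M n m p} {x : Fin M → ℝ → Vec n} {T : ℕ → ℝ}
  {τ τ' : ℕ → Global M p}

theorem InRegion.unique {x : ℝ → Vec n} {t : ℝ} {j k : Fin p} (hj : InRegion S x t j)
    (hk : InRegion S x t k) : j = k := by
  by_contra hne
  obtain ⟨s, h1, h2⟩ := (hj.2.and hk.2).exists
  exact Set.disjoint_left.1 (S.non_overlapping hne) h1 h2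

theorem Follows.exists_induces (h : Follows S x T τ) : ∃ τ', Induces S x τ' := by
  classical
  obtain ⟨h0, -, htop, hreg⟩ := h
  have hf : ∀ i t, ∃ j, 0 ≤ t → InRegion S (x i) t j := by
    intro i t
    by_cases ht : 0 ≤ t
    · obtain ⟨k, hk⟩ := exists_mem_Ico_of_tendsto h0 htop ht
      exact ⟨τ k i, fun _ => hreg k i t hk⟩
    -- An arbitrary value for negative times.
    · exact ⟨τ 0 i, fun h => absurd h ht⟩
  choose f hf using hf
  let s : ℕ → ℝ := fun k => Nat.rec 0
    (fun _ a => if (changedAfter f a).Nonempty then sInf (changedAfter f a) else a) k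
  refine ⟨fun k i => f i (s k), f, hf, s, rfl, fun k => ?_, fun _ _ => rfl⟩
  by_cases hne : (changedAfter f (s k)).Nonempty
  · exact Or.inl ⟨hne, if_pos hne⟩
  · exact Or.inr ⟨not_nonempty_iff_eq_empty.1 hne, if_neg hne⟩

theorem Follows.eq_of_induces (h : Follows S x T τ) (hidle : NoIdleStep τ)
    (hτ' : Induces S x τ') : τ' = τ := by
  obtain ⟨h0, hmono, htop, hreg⟩ := h
  obtain ⟨f, hf, s, hs0, hs, hτf⟩ := hτ'
  have hT0 : ∀ k, 0 ≤ T k := fun k => h0 ▸ hmono.monotone (Nat.zero_le k)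
  have hfτ : ∀ k i, ∀ t ∈ Ico (T k) (T (k + 1)), f i t = τ k i := fun k i t ht =>
    (hf i t ((hT0 k).trans ht.1)).unique (hreg k i t ht)
  have hfT : ∀ k i, f i (T k) = τ k i := fun k i =>
    hfτ k i _ ⟨le_rfl, hmono k.lt_succ_self⟩
  -- The switching times keep pace with the crossing instants (`j = k`) until the path is constant;
  -- then `s` freezes at `T j`.
  have key : ∀ k, ∃ j ≤ k, s k = T j ∧ τ j = τ k ∧ (j < k → ∀ l, j ≤ l → τ l = τ j) := by
    intro k
    induction k with
    | zero => exact ⟨0, le_rfl, by rw [hs0, h0], rfl, fun h => absurd h (lt_irrefl 0)⟩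
    | succ k ih =>
      obtain ⟨j, hjk, hsj, hτj, hconst⟩ := ih
      by_cases hstay : ∀ l, j ≤ l → τ l = τ j
      · have hempty : changedAfter f (s k) = ∅ := by
          refine eq_empty_of_forall_notMem ?_
          rintro t ⟨ht, i, hi⟩
          rw [hsj] at ht hi
          obtain ⟨l, hl⟩ := exists_mem_Ico_of_tendsto h0 htop ((hT0 j).trans ht.le)
          have hjl : j < l + 1 := hmono.lt_iff_lt.1 (ht.trans hl.2)
          exact hi (by rw [hfτ l i t hl, hfT, hstay l (by omega)])
        rcases hs k with ⟨hne, -⟩ | ⟨-, heq⟩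
        · exact absurd hempty hne.ne_empty
        · exact ⟨j, by omega, by rw [heq, hsj], (hstay _ (by omega)).symm, fun _ => hstay⟩
      · obtain rfl : j = k := by
          by_contra hne
          exact hstay (hconst (by omega))
        have hmove : τ (j + 1) ≠ τ j := fun h => hstay (hidle j h)
        obtain ⟨i, hi⟩ := Function.ne_iff.1 hmove
        have hlt := hmono j.lt_succ_self
        -- Regions are constant on `[T j, T (j + 1))` and some agent moves at the right end, so the
        -- infimum is attained there.
        have hleast : IsLeast (changedAfter f (s j)) (T (j + 1)) := by
          rw [hsj]
          refine ⟨⟨hlt, i, by rwa [hfT, hfT]⟩, ?_⟩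
          rintro t ⟨ht, l, hl⟩
          by_contra! hlt'
          exact hl (by rw [hfτ j l t ⟨ht.le, hlt'⟩, hfT])
        rcases hs j with ⟨-, heq⟩ | ⟨hempty, -⟩
        · exact ⟨j + 1, le_rfl, by rw [heq, hleast.csInf_eq], rfl,
            fun h => absurd h (lt_irrefl _)⟩
        · exact absurd hempty (nonempty_of_mem hleast.1).ne_empty
  funext k i
  obtain ⟨j, -, hsj, hτj, -⟩ := key k
  rw [hτf, hsj, hfT, hτj]

end Induced

end SecurePlanning

namespace SecurePlanning

/-! ### The secure abstraction -/

theorem IsShortest.of_eq_some {Z : Type*} {feas : List Z → Prop} {cost : List Z → ℝ}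
    {o : Option (List Z)} {l : List Z} (ho : IsShortest feas cost o) (h : o = some l) :
    feas l := by
  subst h
  exact ho.1

/-- Segments drawn from a finite family have a least duration, which rules out Zeno behaviour. -/
theorem tendsto_startTime {M n m : ℕ} {κ : Type} {segs : ℕ → Segment M n m κ} {E : Type*}
    [Finite E] (e : ℕ → E) (seg : E → Segment M n m κ) (he : ∀ k, segs k = seg (e k))
    (hpos : ∀ k, 0 < (segs k).tf) : Tendsto (startTime segs) atTop atTop := by
  obtain ⟨_, ⟨k₀, rfl⟩, hmin⟩ := exists_min_image (range e) (fun a => (seg a).tf)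
    (toFinite _) (range_nonempty e)
  have hle : ∀ k, (segs k₀).tf ≤ (segs k).tf := fun k => by
    rw [he, he]
    exact hmin _ (mem_range_self k)
  refine tendsto_atTop_mono (fun k => ?_) (tendsto_natCast_atTop_atTop.atTop_mul_const (hpos k₀))
  have := Finset.card_nsmul_le_sum (Finset.range k) (fun l => (segs l).tf) _ fun l _ => hle l
  simpa [startTime] using this

section Abstraction
variable {M p : ℕ} {AP : Fin M → Type*} {Y : Type*} (T : (i : Fin M) → AgentWTS p (AP i) Y)

instance finite_secureAbstraction (sec : Security) : Finite (secureAbstraction T sec).X := by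
  cases sec
  · exact inferInstanceAs (Finite (Global M p × Global M p))
  · exact inferInstanceAs (Finite (Global M p))
  · exact inferInstanceAs (Finite (Global M p × Global M p))

theorem exists_pos_le_gWTS_w (hM : 0 < M) : ∃ c > 0, ∀ q q', c ≤ (gWTS T).w q q' := by
  rcases isEmpty_or_nonempty (Global M p) with h | h
  -- Without global states any positive constant works.
  · exact ⟨1, one_pos, fun q => h.elim q⟩
  · obtain ⟨e, he⟩ := Finite.exists_min fun e : Global M p × Global M p => (gWTS T).w e.1 e.2
    refine ⟨_, ?_, fun q q' => he (q, q')⟩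
    exact Finset.sum_pos (fun i _ => (T i).w_pos _ _) ⟨⟨0, hM⟩, Finset.mem_univ _⟩

theorem secureAbstraction_w (sec : Security) (q q' : (secureAbstraction T sec).X) :
    (secureAbstraction T sec).ts.w q q' =
      (gWTS T).w ((secureAbstraction T sec).part q (secureAbstraction T sec).real)
        ((secureAbstraction T sec).part q' (secureAbstraction T sec).real) := by
  cases sec <;> rfl

theorem secureAbstraction_L (sec : Security) (q : (secureAbstraction T sec).X) :
    (secureAbstraction T sec).ts.L q =
      (gWTS T).L ((secureAbstraction T sec).part q (secureAbstraction T sec).real) := by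
  cases sec <;> rfl

variable {T}

theorem isPath_of_typeB {τ : ℕ → Global M p} (h : (typeBWTS T).IsPath τ) : (gWTS T).IsPath τ :=
  ⟨h.1.1, fun k => (h.2 k).2.2⟩

theorem typeBSecure_of_isPath {τ : ℕ → Global M p} (h : (typeBWTS T).IsPath τ) :
    TypeBSecure T τ := by
  intro i k hi
  obtain ⟨l, hl, heq⟩ := (h.2 k).1 i hi
  exact ⟨l, hl, heq.symm⟩

section Twin
variable {G : TS (Global M p) (Σ i, AP i)} {σ : ℕ → Global M p × Global M p}

theorem isPath_real_of_secureTwin (h : (secureTwin T G).IsPath σ) :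
    G.IsPath fun k => (σ k).1 :=
  ⟨h.1.1.1, fun k => (h.2 k).2.2.1⟩

theorem isPath_copy_of_secureTwin (h : (secureTwin T G).IsPath σ) :
    G.IsPath fun k => (σ k).2 :=
  ⟨h.1.1.2.1, fun k => (h.2 k).2.2.2.1⟩

/-- The copy component is the witness. `hG` lets `G` be the Type-B system as well as the full
product. -/
theorem typeASecure_of_secureTwin (hG : ∀ τ, G.IsPath τ → (gWTS T).IsPath τ)
    (h : (secureTwin T G).IsPath σ) : TypeASecure T fun k => (σ k).1 :=
  ⟨fun k => (σ k).2, hG _ (isPath_copy_of_secureTwin h), fun k => (h.2 k).2.2.2.2.1,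
    fun i k hi hi' => (h.2 k).1 ⟨i, hi, hi'⟩⟩

end Twin

theorem meets_of_isPath {φ : LTL (Σ i, AP i)} {sec : Security}
    {σ : ℕ → (secureAbstraction T sec).X} (h : (secureAbstraction T sec).ts.IsPath σ)
    (hφ : φ.Sat fun k => (secureAbstraction T sec).ts.L (σ k)) :
    Meets T φ sec fun k => (secureAbstraction T sec).part (σ k) (secureAbstraction T sec).real := by
  simp only [secureAbstraction_L] at hφ
  cases sec with
  | typeA =>
    exact ⟨isPath_real_of_secureTwin h, hφ,
      fun _ => typeASecure_of_secureTwin (fun _ => id) h, False.elim⟩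
  | typeB => exact ⟨isPath_of_typeB h, hφ, False.elim, fun _ => typeBSecure_of_isPath h⟩
  | typeAB =>
    have hB := isPath_real_of_secureTwin h
    exact ⟨isPath_of_typeB hB, hφ,
      fun _ => typeASecure_of_secureTwin (fun _ => isPath_of_typeB) h,
      fun _ => typeBSecure_of_isPath hB⟩

end Abstraction

theorem exists_plan_iff {Z : Type*} [Finite Z] {Q : PBA Z} {β c : ℝ} (hc : 0 < c)
    (hw : ∀ z z', c ≤ Q.w z z') {accs : List Z} (haccs : ∀ z, z ∈ accs ↔ z ∈ Q.acc)
    {pre suf : Z → Option (List Z)} (hpre : ∀ z, IsShortest (Q.IsPrefix z) Q.cost (pre z))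
    (hsuf : ∀ z, IsShortest (Q.IsSuffix z) Q.cost (suf z)) :
    ((∃ ρ, Q.IsAccepting ρ) ↔ ∃ π, planSearch Q β pre suf accs = some π) ∧
    ∀ π, planSearch Q β pre suf accs = some π → Q.IsAccepting π.seq := by
  have hacc : ∀ π, planSearch Q β pre suf accs = some π → Q.IsAccepting π.seq := by
    intro π hπ
    obtain ⟨h1, h2, h3⟩ := planSearch_some hπ
    exact Plan.isAccepting_seq ((haccs _).1 h1) ((hpre _).of_eq_some h2)
      ((hsuf _).of_eq_some h3)
  refine ⟨⟨?_, fun ⟨π, hπ⟩ => ⟨_, hacc π hπ⟩⟩, hacc⟩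
  rintro ⟨ρ, hρ⟩
  obtain ⟨z, hz, h1, h2⟩ := hρ.exists_prefix_suffix
  exact exists_planSearch ((haccs z).2 hz)
    ((hpre z).exists_some (PBA.exists_least_cost hc hw h1))
    ((hsuf z).exists_some (PBA.exists_least_cost hc hw h2))

end SecurePlanning

/-! ### Assembly of the discrete and continuous halves -/

theorem theorem1 {M n m p : ℕ} (hM : 0 < M) {AP : Fin M → Type*} {Y : Type*}
    (S : System M n m p) (T : (i : Fin M) → AgentWTS p (AP i) Y)
    (φ : LTL (Σ i, AP i)) (B : NBA (Set (Σ i, AP i))) (hB : ∀ r, B.Accepts r ↔ φ.Sat r)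
    (sec : Security) (γ ε β : ℝ) (hγ : 0 < γ) (hε : 0 < ε) (hβ : β ∈ Set.Icc (0 : ℝ) 1)
    -- the transition check: `keep` are the transitions retained, `seg` the segments it returns
    (keep : (secureAbstraction T sec).X → (secureAbstraction T sec).X → Prop)
    (seg : (secureAbstraction T sec).X → (secureAbstraction T sec).X →
      Segment M n m (secureAbstraction T sec).κ)
    (hseg : ∀ q q', (secureAbstraction T sec).ts.trans q q' → keep q q' →
      (seg q q').Realizes S γ ε ((secureAbstraction T sec).part q)
        ((secureAbstraction T sec).part q'))
    -- the product automaton, its accepting states in any order, and the shortest-path routines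
    (Q : PBA ((secureAbstraction T sec).X × B.S))
    (hQ : Q = product ((secureAbstraction T sec).ts.prune keep) B)
    (accs : List ((secureAbstraction T sec).X × B.S)) (haccs : ∀ z, z ∈ accs ↔ z ∈ Q.acc)
    (pre suf : (secureAbstraction T sec).X × B.S →
      Option (List ((secureAbstraction T sec).X × B.S)))
    (hpre : ∀ z, IsShortest (Q.IsPrefix z) Q.cost (pre z))
    (hsuf : ∀ z, IsShortest (Q.IsSuffix z) Q.cost (suf z)) :
    -- the search succeeds exactly if there is an accepting path
    ((∃ ρ, Q.IsAccepting ρ) ↔ ∃ π, planSearch Q β pre suf accs = some π) ∧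
    ∀ π, planSearch Q β pre suf accs = some π →
      let σ : ℕ → (secureAbstraction T sec).X := fun k => (π.seq k).1
      let segs : ℕ → Segment M n m (secureAbstraction T sec).κ :=
        fun k => seg (σ k) (σ (k + 1))
      let path : (secureAbstraction T sec).κ → ℕ → Global M p :=
        fun c k => (secureAbstraction T sec).part (σ k) c
      let real := (secureAbstraction T sec).real
      -- the trajectories, real and copy, are dynamically feasible
      (∀ c, DynamicallyFeasible S (concatX segs c) (concatU segs c)) ∧
      (∀ c k i, concatX segs c i (startTime segs k) = (S.cell (path c k i)).centroid) ∧
      -- they follow the discrete plan, which satisfies the formula and is secure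
      (∀ c, Follows S (concatX segs c) (stepTime segs) (path c)) ∧
      Meets T φ sec (path real) ∧
      -- and so does the path induced by the switching times of the real trajectory
      (NoIdleStep (path real) →
        (∃! τ, Induces S (concatX segs real) τ) ∧
        ∀ τ, Induces S (concatX segs real) τ → Meets T φ sec τ) := by
  subst hQ
  have := B.finite
  obtain ⟨c, hc, hw⟩ := exists_pos_le_gWTS_w T hM
  obtain ⟨hiff, hacc⟩ := exists_plan_iff (β := β) hc
    (fun z z' => (hw _ _).trans (secureAbstraction_w T sec z.1 z'.1).ge) haccs hpre hsuf
  refine ⟨hiff, fun π hπ => ?_⟩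
  obtain ⟨hinit, hδ, hfreq⟩ := hacc π hπ
  intro σ segs path real
  have hR : ∀ k, (segs k).Realizes S γ ε ((secureAbstraction T sec).part (σ k))
      ((secureAbstraction T sec).part (σ (k + 1))) :=
    fun k => hseg _ _ (hδ k).1.1 (hδ k).1.2
  have hT : Tendsto (startTime segs) atTop atTop :=
    -- Each segment depends only on a pair of abstraction states, and such pairs are finitely many.
    tendsto_startTime (fun k => (σ k, σ (k + 1))) (fun e => seg e.1 e.2) (fun _ => rfl)
      fun k => (hR k).tf_pos
  have hsat : φ.Sat fun k => (secureAbstraction T sec).ts.L (σ k) :=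
    (hB _).1 ⟨fun k => (π.seq k).2, hinit.2, fun k => (hδ k).2, hfreq.mono fun _ hk => hk.2⟩
  have hmeets : Meets T φ sec (path real) :=
    meets_of_isPath ⟨hinit.1, fun k => (hδ k).1.1⟩ hsat
  have hfollows : ∀ c, Follows S (concatX segs c) (stepTime segs) (path c) :=
    fun c => follows_concatX hR hT hγ hε c
  refine ⟨fun c => dynamicallyFeasible_concat hR hT hγ hε c,
    fun c k i => concatX_startTime hR c k i, hfollows, hmeets, fun hidle => ?_⟩
  have heq : ∀ τ, Induces S (concatX segs real) τ → τ = path real :=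
    fun τ hτ => (hfollows real).eq_of_induces hidle hτ
  obtain ⟨τ, hτ⟩ := (hfollows real).exists_induces
  exact ⟨⟨τ, hτ, fun τ' hτ' => (heq τ' hτ').trans (heq τ hτ).symm⟩,
    fun τ' hτ' => (heq τ' hτ').symm ▸ hmeets⟩
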